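/- Let $N \ge 0$ and $M \ge 1$ be integers and let $V : \mathbb{R}_+ \to \mathbb{R} \cup \{\infty\}$ be a measurable function such that $$0 < \int_{\mathbb{C}^N} \prod_{1 \le i<j \le N} |z_i-z_j|^2 \, e^{-\sum_{i=1}^N V(|z_i|^2)} \, \mathrm{d}m(z_1)\cdots \mathrm{d}m(z_N) < \infty ,$$ where $m$ is Lebesgue measure on $\mathbb{C}$. For a finite ordered index set $I$ and such a potential $W$, let $\mathrm{E}_{(W)}(I)$ denote the $\beta=2$ ensemble with radial potential $W$, i.e. the probability law on $\mathbb{C}^I$ with density proportional to $\prod_{i<j} |z_i-z_j|^2 \prod_{i} e^{-W(|z_i|^2)}$ with respect to Lebesgue measure, and let $\mathrm{E}(N)=\mathrm{E}_{(V)}(\{1,\dots,N\})$. For $1\le k\le M$ put $I_k = \{ i \in \{1,\dots,N\} : i \equiv k \ (\mathrm{mod}\ M)\}$, let the Root distribution $\mathrm{R}_V(N,M,k)$ be the probability law on $\mathbb{C}^{I_k}$ with density proportional to $$\prod_{i<j,\ i,j\in I_k} |z_i^M - z_j^M|^2 \prod_{i \in I_k} |z_i|^{2(k-1)} e^{-V(|z_i|^2)},$$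 and let the Power ensemble $\mathrm{E}(N,M,k)$ be the image of $\mathrm{R}_V(N,M,k)$ under $z \mapsto z^M$ applied to each coordinate. Theorem (General Power decomposition). All these laws are well defined (the densities have finite nonzero integrals). For each $k$, $\mathrm{E}(N,M,k)$ is again a $\beta=2$ ensemble: $\mathrm{E}(N,M,k) = \mathrm{E}_{(W_{M,k})}(I_k)$ with potential $$W_{M,k}(x) = V(x^{1/M}) - \frac{k-M}{M}\log x .$$ If $(\lambda_1,\dots,\lambda_N)$ has law $\mathrm{E}(N)$, and the families $(z_i)_{i\in I_k}$ have laws $\mathrm{R}_V(N,M,k)$ and are independent for different $k$, then there is equality in distribution of sets of points with multiplicity (as point processes, i.e. as random counting measures) $$\{\lambda_1^M,\dots,\lambda_N^M\} \stackrel{d}{=} \{z_1^M,\dots,z_N^M\}.$$ In other words, the $M$-th power of $\mathrm{E}(N)$ is a superposition of $M$ independent Power ensembles: $$\mathrm{E}(N)^M \stackrel{d}{=} \bigcup_{k=1}^M \mathrm{R}_V(N,M,k)^M \stackrel{d}{=} \bigcup_{k=1}^M \mathrm{E}(N,M,k).$$ -/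

import Mathlib

open MeasureTheory
open scoped ENNReal NNReal

noncomputable section

/-- The probability law on `ℂ^ι` whose density with respect to Lebesgue measure is `f`, divided by
its integral. (It is a probability measure exactly when `0 < ∫ f < ∞`.) -/
def lawOfDensity {ι : Type*} [Fintype ι] (f : (ι → ℂ) → ℝ≥0∞) : Measure (ι → ℂ) :=
  (∫⁻ z, f z)⁻¹ • (volume : Measure (ι → ℂ)).withDensity f

/-- The unnormalised density `∏_{i<j} |z_i - z_j|^β ∏_i e^{-V(|z_i|²)}` of the beta ensemble with
radial potential `V : ℝ₊ → ℝ ∪ {∞}`, for points indexed by a finite ordered set `ι`. -/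
def betaDensity (β : ℝ) (V : ℝ≥0 → EReal) (ι : Type*) [Fintype ι] [LinearOrder ι]
    (z : ι → ℂ) : ℝ≥0∞ :=
  (∏ p : ι × ι with p.1 < p.2, ‖z p.1 - z p.2‖ₑ ^ β) * ∏ i, EReal.exp (-V (‖z i‖₊ ^ 2))

/-- `V` is a potential (measurable, with values in `ℝ ∪ {∞}`) for which the density of the beta
ensemble indexed by `ι` has a finite and nonzero integral, so that it can be normalised. -/
structure IsAdmissiblePotential (β : ℝ) (V : ℝ≥0 → EReal) (ι : Type*) [Fintype ι]
    [LinearOrder ι] : Prop where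
  measurable : Measurable V
  ne_bot : ∀ t, V t ≠ ⊥
  integral_ne_top : ∫⁻ z, betaDensity β V ι z ≠ ∞
  integral_ne_zero : ∫⁻ z, betaDensity β V ι z ≠ 0

/-- The beta ensemble with radial potential `V`, for points indexed by `ι`. -/
def betaEnsemble (β : ℝ) (V : ℝ≥0 → EReal) (ι : Type*) [Fintype ι] [LinearOrder ι] :
    Measure (ι → ℂ) :=
  lawOfDensity (betaDensity β V ι)

/-- The arithmetic progression `I_{N,M,k} = {i ∈ {1, …, N} | i ≡ k mod M}`. -/
def progression (N M k : ℕ) : Finset ℕ :=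
  {i ∈ Finset.Icc 1 N | i ≡ k [MOD M]}

/-- The unnormalised density
`∏_{i<j} |z_i^M - z_j^M|² ∏_i |z_i|^{2(k-1)} e^{-V(|z_i|²)}`, `i, j ∈ I_{N,M,k}`
(used for `k ≥ 1` only). -/
def rootDensity (V : ℝ≥0 → EReal) (N M k : ℕ) (z : progression N M k → ℂ) : ℝ≥0∞ :=
  (∏ p : progression N M k × progression N M k with p.1 < p.2,
      ‖z p.1 ^ M - z p.2 ^ M‖ₑ ^ 2) *
    ∏ i, (‖z i‖ₑ ^ (2 * (k - 1)) * EReal.exp (-V (‖z i‖₊ ^ 2)))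

/-- The Root distribution `R_V(N,M,k)`, a law of points indexed by `I_{N,M,k}`. -/
def rootEnsemble (V : ℝ≥0 → EReal) (N M k : ℕ) : Measure (progression N M k → ℂ) :=
  lawOfDensity (rootDensity V N M k)

/-- The Power distribution `E(N,M,k)`: the image of the Root distribution under `z ↦ z^M`. -/
def powerEnsemble (V : ℝ≥0 → EReal) (N M k : ℕ) : Measure (progression N M k → ℂ) :=
  (rootEnsemble V N M k).map (fun z i => z i ^ M)

/-- The potential `W_{M,k}(x) = V(x^{1/M}) - ((k - M)/M) log x`. (The value at the single point
`x = 0` plays no role.) -/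
def powerPotential (V : ℝ≥0 → EReal) (M k : ℕ) (x : ℝ≥0) : EReal :=
  V (x ^ (1 / (M : ℝ))) - ((((k : ℝ) - M) / M * Real.log x : ℝ) : EReal)

/-- The set (with multiplicities) `{z_i | i ∈ ι}`, as the counting measure `∑_i δ_{z_i}`. -/
def pointSet {ι : Type*} [Fintype ι] (z : ι → ℂ) : Measure ℂ :=
  ∑ i, Measure.dirac (z i)

theorem measurable_pointSet {ι : Type*} [Fintype ι] :
    Measurable (pointSet : (ι → ℂ) → Measure ℂ) := by
  refine Measure.measurable_of_measurable_coe _ fun s hs => ?_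
  simp only [pointSet, Measure.coe_finsetSum, Finset.sum_apply]
  exact Finset.measurable_sum _ fun i _ =>
    (Measure.measurable_coe hs).comp (Measure.measurable_dirac.comp (measurable_pi_apply i))

/-- The point process (law of the unordered set of points) of a random tuple with law `P`. -/
def pointProcess {ι : Type*} [Fintype ι] (P : Measure (ι → ℂ)) : Measure (Measure ℂ) :=
  P.map pointSet

/-- The superposition (union) of independent point processes, the `k`-th one being the set of
points of a random tuple with law `P k`. -/
def superposition {κ : Type*} [Fintype κ] {ι : κ → Type*} [∀ k, Fintype (ι k)]
    (P : ∀ k, Measure (ι k → ℂ)) : Measure (Measure ℂ) :=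
  (Measure.pi P).map (fun z => ∑ k, pointSet (z k))

theorem measurable_sum_pointSet {κ : Type*} [Fintype κ] {ι : κ → Type*} [∀ k, Fintype (ι k)] :
    Measurable (fun z : ∀ k, ι k → ℂ => ∑ k, pointSet (z k)) := by
  refine Measure.measurable_of_measurable_coe _ fun s hs => ?_
  simp only [Measure.coe_finsetSum, Finset.sum_apply]
  exact Finset.measurable_sum _ fun k _ =>
    (Measure.measurable_coe hs).comp (measurable_pointSet.comp (measurable_pi_apply k))

end

open MeasureTheory
open scoped ENNReal NNReal

noncomputable section

theorem lintegral_fin_prod_eq_prod {n : ℕ} {E : Fin n → Type*}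
    {mE : ∀ i, MeasurableSpace (E i)} {μ : (i : Fin n) → Measure (E i)} [∀ i, SigmaFinite (μ i)]
    (f : (i : Fin n) → E i → ℝ≥0∞) (hf : ∀ i, Measurable (f i)) :
    ∫⁻ x : (i : Fin n) → E i, ∏ i, f i (x i) ∂(Measure.pi μ) = ∏ i, ∫⁻ x, f i x ∂(μ i) := by
  induction n with
  | zero => simp
  | succ n n_ih =>
    calc
      _ = ∫⁻ x : E 0 × ((i : Fin n) → E (Fin.succ i)),
            f 0 x.1 * ∏ i : Fin n, f (Fin.succ i) (x.2 i)
            ∂((μ 0).prod (Measure.pi (fun i ↦ μ i.succ))) := by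
          rw [← ((measurePreserving_piFinSuccAbove μ 0).symm).lintegral_comp_emb
            (MeasurableEquiv.measurableEmbedding _)]
          refine lintegral_congr fun x => ?_
          rw [Fin.prod_univ_succ]
          rfl
      _ = (∫⁻ x, f 0 x ∂μ 0)
            * ∏ i : Fin n, ∫⁻ (x : E (Fin.succ i)), f (Fin.succ i) x ∂(μ i.succ) := by
          rw [← n_ih _ fun i => hf _]
          exact lintegral_prod_mul (hf 0).aemeasurable (Finset.measurable_prod _ fun i _ =>
            (hf (Fin.succ i)).comp (measurable_pi_apply i)).aemeasurable
      _ = ∏ i, ∫⁻ x, f i x ∂(μ i) := by rw [Fin.prod_univ_succ]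

theorem lintegral_fintype_prod_eq_prod {ι : Type*} [Fintype ι] {E : ι → Type*}
    {mE : ∀ i, MeasurableSpace (E i)} {μ : (i : ι) → Measure (E i)} [∀ i, SigmaFinite (μ i)]
    (f : (i : ι) → E i → ℝ≥0∞) (hf : ∀ i, Measurable (f i)) :
    ∫⁻ x : (i : ι) → E i, ∏ i, f i (x i) ∂(Measure.pi μ) = ∏ i, ∫⁻ x, f i x ∂(μ i) := by
  let e := (Fintype.equivFin ι).symm
  rw [← (measurePreserving_piCongrLeft _ e).lintegral_comp_emb
    (MeasurableEquiv.measurableEmbedding _)]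
  simp_rw [← e.prod_comp, MeasurableEquiv.coe_piCongrLeft, Equiv.piCongrLeft_apply_apply]
  exact lintegral_fin_prod_eq_prod _ fun i => hf _

theorem pi_withDensity {ι : Type*} [Fintype ι] {E : ι → Type*}
    {mE : ∀ i, MeasurableSpace (E i)} {μ : (i : ι) → Measure (E i)} [∀ i, SigmaFinite (μ i)]
    (f : (i : ι) → E i → ℝ≥0∞) (hf : ∀ i, Measurable (f i))
    [∀ i, SigmaFinite ((μ i).withDensity (f i))] :
    Measure.pi (fun i => (μ i).withDensity (f i)) =
      (Measure.pi μ).withDensity (fun x => ∏ i, f i (x i)) := by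
  refine (Measure.pi_eq fun s hs => ?_)
  rw [withDensity_apply _ (.univ_pi hs), ← lintegral_indicator (.univ_pi hs)]
  simp_rw [withDensity_apply _ (hs _), ← lintegral_indicator (hs _)]
  rw [← lintegral_fintype_prod_eq_prod _ fun i => (hf i).indicator (hs i)]
  refine lintegral_congr fun x => ?_
  classical
  by_cases hx : x ∈ Set.univ.pi s
  · rw [Set.indicator_of_mem hx]
    exact Finset.prod_congr rfl fun i _ => (Set.indicator_of_mem (hx i trivial) _).symm
  · rw [Set.indicator_of_notMem hx]
    simp only [Set.mem_pi, Set.mem_univ, true_implies, not_forall] at hx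
    obtain ⟨i, hi⟩ := hx
    exact (Finset.prod_eq_zero (Finset.mem_univ i) (Set.indicator_of_notMem hi _)).symm

theorem volume_preserving_sigmaUncurry {κ : Type*} [Fintype κ] {ι : κ → Type*}
    [∀ k, Fintype (ι k)] :
    MeasurePreserving (MeasurableEquiv.piCurry fun (k : κ) (_ : ι k) => ℂ).symm := by
  refine ⟨MeasurableEquiv.measurable _, ?_⟩
  refine (Measure.pi_eq fun s hs => ?_).symm
  rw [MeasurableEquiv.map_apply]
  have : (MeasurableEquiv.piCurry fun (k : κ) (_ : ι k) => ℂ).symm ⁻¹' Set.univ.pi s =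
      Set.univ.pi fun k => Set.univ.pi fun j => s ⟨k, j⟩ := by
    ext z
    simp only [MeasurableEquiv.coe_piCurry_symm, Set.mem_preimage, Set.mem_univ_pi, Sigma.uncurry]
    exact ⟨fun h k j => h ⟨k, j⟩, fun h p => h p.1 p.2⟩
  rw [this, volume_pi, Measure.pi_pi, Fintype.prod_sigma]
  simp_rw [volume_pi, Measure.pi_pi]

theorem isProbabilityMeasure_lawOfDensity {ι : Type*} [Fintype ι] {f : (ι → ℂ) → ℝ≥0∞}
    (h0 : ∫⁻ z, f z ≠ 0) (h1 : ∫⁻ z, f z ≠ ∞) : IsProbabilityMeasure (lawOfDensity f) := by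
  constructor
  rw [lawOfDensity, Measure.smul_apply, withDensity_apply _ .univ, Measure.restrict_univ,
    smul_eq_mul, ENNReal.inv_mul_cancel h0 h1]

theorem pi_lawOfDensity {κ : Type*} [Fintype κ] {ι : κ → Type*} [∀ k, Fintype (ι k)]
    {f : ∀ k, (ι k → ℂ) → ℝ≥0∞} (hf : ∀ k, Measurable (f k))
    (h0 : ∀ k, ∫⁻ z, f k z ≠ 0) (h1 : ∀ k, ∫⁻ z, f k z ≠ ∞) :
    Measure.pi (fun k => lawOfDensity (f k)) =
      (∏ k, ∫⁻ z, f k z)⁻¹ •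
        (volume : Measure (∀ k, ι k → ℂ)).withDensity (fun z => ∏ k, f k (z k)) := by
  have key : ∀ k, lawOfDensity (f k) =
      volume.withDensity (fun z => (∫⁻ z, f k z)⁻¹ * f k z) := fun k => by
    rw [lawOfDensity, ← withDensity_smul _ (hf k)]
    rfl
  have hp := fun k => isProbabilityMeasure_lawOfDensity (h0 k) (h1 k)
  have : ∀ k, SigmaFinite ((volume : Measure (ι k → ℂ)).withDensity
      (fun z => (∫⁻ z, f k z)⁻¹ * f k z)) := fun k => by
    rw [← key]; infer_instance
  simp_rw [key]
  have hm : Measurable fun z : ∀ k, ι k → ℂ => ∏ k, f k (z k) :=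
    Finset.measurable_prod _ fun k _ => (hf k).comp (measurable_pi_apply k)
  rw [pi_withDensity _ fun k => (hf k).const_mul _, ← withDensity_smul _ hm]
  congr 1
  ext z
  rw [Finset.prod_mul_distrib, Pi.smul_apply, smul_eq_mul,
    ENNReal.prod_inv_distrib]
  exact fun i _ j _ _ => .inl (h0 i)

theorem setLIntegral_Ioo_exp_mul_nat {M : ℕ} (hM : M ≠ 0) (g : ℂ → ℝ≥0∞) (hg : Measurable g) :
    ∫⁻ t in Set.Ioo (-Real.pi) Real.pi, g (Complex.exp (t * Complex.I) ^ M) =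
      ∫⁻ t in Set.Ioo (-Real.pi) Real.pi, g (Complex.exp (t * Complex.I)) := by
  have : Fact (0 < 2 * Real.pi) := ⟨Real.two_pi_pos⟩
  have hc : ∀ t : ℝ, ((AddCircle.toCircle (t : AddCircle (2 * Real.pi)) : Circle) : ℂ) =
      Complex.exp (t * Complex.I) := fun t => by
    rw [AddCircle.toCircle_apply_mk, div_self Real.two_pi_pos.ne', one_mul, Circle.coe_exp]
  have hpi : -Real.pi + 2 * Real.pi = Real.pi := by ring
  have h := AddCircle.lintegral_preimage (2 * Real.pi) (-Real.pi)
  simp only [hpi] at h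
  have hm : Measurable fun b : AddCircle (2 * Real.pi) => g (b.toCircle : ℂ) :=
    hg.comp (continuous_subtype_val.comp AddCircle.continuous_toCircle).measurable
  have hmp : MeasurePreserving (fun b : AddCircle (2 * Real.pi) => (M : ℤ) • b) :=
    Measure.measurePreserving_zsmul volume (by exact_mod_cast hM)
  have h1 := hmp.lintegral_comp hm
  rw [← h, ← h] at h1
  simp only [restrict_Ioo_eq_restrict_Ioc]
  simpa only [natCast_zsmul, AddCircle.toCircle_nsmul, Circle.coe_pow, hc] using h1

theorem lintegral_eq_polar (g : ℂ → ℝ≥0∞) (hg : Measurable g) :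
    ∫⁻ z, g z = ∫⁻ r in Set.Ioi (0 : ℝ), ENNReal.ofReal r *
      ∫⁻ t in Set.Ioo (-Real.pi) Real.pi, g (r * Complex.exp (t * Complex.I)) := by
  rw [← Complex.lintegral_comp_polarCoord_symm, polarCoord_target, Measure.volume_eq_prod,
    ← Measure.prod_restrict, lintegral_prod]
  · refine lintegral_congr fun r => ?_
    rw [← lintegral_const_mul _ (by fun_prop)]
    refine lintegral_congr fun t => ?_
    rw [Complex.polarCoord_symm_apply, smul_eq_mul, Complex.exp_mul_I]
    simp
  · simp only [Complex.polarCoord_symm_apply, smul_eq_mul]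
    fun_prop

theorem lintegral_comp_pow {M : ℕ} (hM : M ≠ 0) (g : ℂ → ℝ≥0∞) (hg : Measurable g) :
    ∫⁻ z : ℂ, (M * ‖z‖ₑ ^ (2 * (M - 1))) * g (z ^ M) = ∫⁻ z, g z := by
  rw [lintegral_eq_polar _ (by fun_prop), lintegral_eq_polar _ hg]
  have himg : (fun r : ℝ => r ^ M) '' Set.Ioi 0 = Set.Ioi 0 := by
    ext x
    constructor
    · rintro ⟨r, hr, rfl⟩
      exact pow_pos (Set.mem_Ioi.1 hr) M
    · intro hx
      exact ⟨x ^ (M : ℝ)⁻¹, Real.rpow_pos_of_pos hx _,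
        Real.rpow_inv_natCast_pow (Set.mem_Ioi.1 hx).le hM⟩
  conv_rhs => rw [← himg]
  rw [lintegral_image_eq_lintegral_abs_deriv_mul (f' := fun r => M * r ^ (M - 1)) measurableSet_Ioi
    (fun r _ => (hasDerivAt_pow M r).hasDerivWithinAt)
    fun a ha b hb hab => (pow_left_inj₀ (Set.mem_Ioi.1 ha).le (Set.mem_Ioi.1 hb).le hM).1 hab]
  refine setLIntegral_congr_fun measurableSet_Ioi fun r hr => ?_
  have hr : 0 < r := hr
  have hn : ∀ t : ℝ, ‖(r : ℂ) * Complex.exp (t * Complex.I)‖ₑ = ENNReal.ofReal r := fun t => by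
    rw [← ofReal_norm, norm_mul, Complex.norm_exp_ofReal_mul_I, mul_one, Complex.norm_real,
      Real.norm_of_nonneg hr.le]
  simp only [hn, mul_pow]
  rw [lintegral_const_mul _ (by fun_prop),
    setLIntegral_Ioo_exp_mul_nat hM (fun u => g ((r : ℂ) ^ M * u)) (by fun_prop), ← mul_assoc,
    ← mul_assoc, ← ENNReal.ofReal_pow hr.le, abs_of_pos (by positivity),
    ← ENNReal.ofReal_natCast, ← ENNReal.ofReal_mul hr.le,
    ← ENNReal.ofReal_mul (show 0 ≤ r * (M : ℝ) by positivity), ← mul_assoc,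
    ← ENNReal.ofReal_mul (show 0 ≤ (M : ℝ) * r ^ (M - 1) by positivity)]
  obtain ⟨m, rfl⟩ := Nat.exists_eq_succ_of_ne_zero hM
  congr 2
  · simp only [Nat.succ_eq_add_one, Nat.add_sub_cancel]
    ring
  · push_cast
    rfl

theorem measurePreserving_pow_withDensity {M : ℕ} (hM : M ≠ 0) :
    MeasurePreserving (fun z : ℂ => z ^ M)
      (volume.withDensity fun z => M * ‖z‖ₑ ^ (2 * (M - 1))) volume := by
  refine ⟨by fun_prop, Measure.ext_of_lintegral _ fun g hg => ?_⟩
  rw [lintegral_map hg (by fun_prop), lintegral_withDensity_eq_lintegral_mul _ (by fun_prop)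
    (by fun_prop)]
  exact lintegral_comp_pow hM g hg

theorem measurePreserving_pi_pow_withDensity {ι : Type*} [Fintype ι] {M : ℕ} (hM : M ≠ 0) :
    MeasurePreserving (fun (z : ι → ℂ) i => z i ^ M)
      (volume.withDensity fun z => ∏ i, (M * ‖z i‖ₑ ^ (2 * (M - 1)))) volume := by
  have : SigmaFinite ((volume : Measure ℂ).withDensity fun z => M * ‖z‖ₑ ^ (2 * (M - 1))) :=
    SigmaFinite.withDensity_of_ne_top' fun z =>
      ENNReal.mul_ne_top (ENNReal.natCast_ne_top _) (ENNReal.pow_ne_top enorm_ne_top)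
  have h := measurePreserving_pi (fun _ : ι => (volume : Measure ℂ).withDensity
    fun z => M * ‖z‖ₑ ^ (2 * (M - 1))) (fun _ => volume)
    fun _ => measurePreserving_pow_withDensity hM
  rwa [pi_withDensity _ fun _ => by fun_prop] at h

/-- The matrix `(z_i ^ e_j)` restricted to the entries with `e_j ≡ c_i mod M`. -/
def classMatrix {ι : Type*} (M : ℕ) (e : ι → ℕ) (c : ι → Fin M) (z : ι → ℂ) : Matrix ι ι ℂ :=
  .of fun i j => if e j % M = c i then z i ^ e j else 0

section Algebra

variable {ι : Type*} [Fintype ι] [DecidableEq ι] {M : ℕ} (e : ι → ℕ)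

theorem sum_det_classMatrix (hM : 0 < M) (z : ι → ℂ) :
    ∑ c : ι → Fin M, (classMatrix M e c z).det = (Matrix.of fun i j => z i ^ e j).det := by
  have h := (Matrix.detRowAlternating (n := ι) (R := ℂ)).toMultilinearMap.map_sum
    (fun (i : ι) (k : Fin M) (j : ι) => if e j % M = k then z i ^ e j else 0)
  refine (Eq.trans ?_ h).symm
  change Matrix.det _ = Matrix.det _
  congr 1
  ext i j
  rw [Finset.sum_apply, Finset.sum_eq_single ⟨e j % M, Nat.mod_lt _ hM⟩]
  · simp
  · intro k _ hk
    rw [if_neg]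
    exact fun h => hk (Fin.ext h.symm)
  · simp

theorem det_classMatrix_rotate {ω : ℂ} (hω : ω ^ M = 1) (a : ι → Fin M) (c : ι → Fin M)
    (z : ι → ℂ) :
    (classMatrix M e c fun i => ω ^ (a i : ℕ) * z i).det =
      (∏ i, ω ^ ((a i : ℕ) * (c i : ℕ))) * (classMatrix M e c z).det := by
  rw [← Matrix.det_mul_column]
  congr 1
  ext i j
  simp only [classMatrix, Matrix.of_apply]
  split_ifs with h
  · rw [mul_pow, ← h, ← pow_mul]
    congr 1
    conv_lhs => rw [← Nat.mod_add_div (e j) M]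
    rw [mul_add, pow_add, mul_left_comm, pow_mul ω M, hω, one_pow, mul_one]
  · simp

theorem sum_pow_mul_conj_pow {ω : ℂ} (hω : IsPrimitiveRoot ω M) (hM : M ≠ 0) (b c : Fin M) :
    ∑ x : Fin M, ω ^ ((x : ℕ) * (b : ℕ)) * (starRingEnd ℂ) (ω ^ ((x : ℕ) * (c : ℕ))) =
      if b = c then (M : ℂ) else 0 := by
  have hn : ‖ω‖ = 1 := hω.norm'_eq_one hM
  have hinv : (starRingEnd ℂ) (ω ^ (c : ℕ)) = (ω ^ (c : ℕ))⁻¹ :=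
    (Complex.inv_eq_conj (by rw [norm_pow, hn, one_pow])).symm
  have h0 : ω ^ (c : ℕ) ≠ 0 := pow_ne_zero _ (hω.ne_zero hM)
  have : ∀ x : Fin M, ω ^ ((x : ℕ) * (b : ℕ)) * (starRingEnd ℂ) (ω ^ ((x : ℕ) * (c : ℕ))) =
      (ω ^ (b : ℕ) * (ω ^ (c : ℕ))⁻¹) ^ (x : ℕ) := fun x => by
    rw [mul_comm (x : ℕ), mul_comm (x : ℕ), pow_mul, pow_mul, map_pow, hinv, mul_pow]
  simp_rw [this]
  rw [Fin.sum_univ_eq_sum_range (fun x => (ω ^ (b : ℕ) * (ω ^ (c : ℕ))⁻¹) ^ x)]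
  split_ifs with h
  · rw [h, mul_inv_cancel₀ h0]
    simp
  · have h1 : ω ^ (b : ℕ) * (ω ^ (c : ℕ))⁻¹ ≠ 1 := fun h1 =>
      h (Fin.ext (hω.pow_inj b.2 c.2 ((mul_inv_eq_one₀ h0).1 h1)))
    rw [geom_sum_eq h1, mul_pow, inv_pow, ← pow_mul, ← pow_mul, mul_comm _ M, mul_comm _ M,
      pow_mul, pow_mul, hω.pow_eq_one]
    simp

theorem sum_normSq_det_rotate (hM : M ≠ 0) {ω : ℂ} (hω : IsPrimitiveRoot ω M) (z : ι → ℂ) :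
    ∑ a : ι → Fin M, Complex.normSq
        (Matrix.of fun i j => (ω ^ (a i : ℕ) * z i) ^ e j : Matrix ι ι ℂ).det =
      M ^ Fintype.card ι * ∑ c : ι → Fin M, Complex.normSq (classMatrix M e c z).det := by
  apply Complex.ofReal_injective
  push_cast
  simp_rw [← Complex.mul_conj, ← sum_det_classMatrix e (Nat.pos_of_ne_zero hM),
    det_classMatrix_rotate e hω.pow_eq_one, map_sum, map_mul, map_prod, Finset.sum_mul_sum]
  have : ∀ a b c : ι → Fin M,
      ((∏ i, ω ^ ((a i : ℕ) * (b i : ℕ))) * (classMatrix M e b z).det) *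
        ((∏ i, (starRingEnd ℂ) (ω ^ ((a i : ℕ) * (c i : ℕ)))) *
          (starRingEnd ℂ) (classMatrix M e c z).det) =
      (∏ i, ω ^ ((a i : ℕ) * (b i : ℕ)) * (starRingEnd ℂ) (ω ^ ((a i : ℕ) * (c i : ℕ)))) *
        ((classMatrix M e b z).det * (starRingEnd ℂ) (classMatrix M e c z).det) :=
    fun a b c => by rw [Finset.prod_mul_distrib]; ring
  simp_rw [this]
  rw [Finset.sum_comm, Finset.mul_sum]
  refine Finset.sum_congr rfl fun b _ => ?_
  rw [Finset.sum_comm]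
  simp_rw [← Finset.sum_mul]
  have key : ∀ c : ι → Fin M, ∑ a : ι → Fin M,
      ∏ i, ω ^ ((a i : ℕ) * (b i : ℕ)) * (starRingEnd ℂ) (ω ^ ((a i : ℕ) * (c i : ℕ))) =
        if b = c then (M : ℂ) ^ Fintype.card ι else 0 := fun c => by
    rw [← Fintype.prod_sum fun i (x : Fin M) =>
      ω ^ ((x : ℕ) * (b i : ℕ)) * (starRingEnd ℂ) (ω ^ ((x : ℕ) * (c i : ℕ)))]
    simp_rw [sum_pow_mul_conj_pow hω hM]
    split_ifs with h
    · simp [h]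
    · obtain ⟨i, hi⟩ := Function.ne_iff.1 h
      exact Finset.prod_eq_zero (Finset.mem_univ i) (if_neg hi)
  simp_rw [key]
  simp

theorem sum_enorm_det_rotate (hM : M ≠ 0) {ω : ℂ} (hω : IsPrimitiveRoot ω M) (z : ι → ℂ) :
    ∑ a : ι → Fin M,
        ‖(Matrix.of fun i j => (ω ^ (a i : ℕ) * z i) ^ e j : Matrix ι ι ℂ).det‖ₑ ^ 2 =
      M ^ Fintype.card ι * ∑ c : ι → Fin M, ‖(classMatrix M e c z).det‖ₑ ^ 2 := by
  have h : ∀ w : ℂ, ‖w‖ₑ ^ 2 = ENNReal.ofReal (Complex.normSq w) := fun w => by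
    rw [Complex.normSq_eq_norm_sq, ENNReal.ofReal_pow (norm_nonneg _), ofReal_norm]
  simp_rw [h]
  rw [← ENNReal.ofReal_sum_of_nonneg fun _ _ => Complex.normSq_nonneg _,
    ← ENNReal.ofReal_sum_of_nonneg fun _ _ => Complex.normSq_nonneg _,
    sum_normSq_det_rotate e hM hω, ENNReal.ofReal_mul (by positivity),
    ENNReal.ofReal_pow (by positivity), ENNReal.ofReal_natCast]

theorem exists_perm_of_det_classMatrix_ne_zero {c : ι → Fin M} {z : ι → ℂ}
    (h : (classMatrix M e c z).det ≠ 0) : ∃ σ : Equiv.Perm ι, ∀ i, (c i : ℕ) = e (σ i) % M := by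
  rw [Matrix.det_apply] at h
  obtain ⟨σ, -, hσ⟩ := Finset.exists_ne_zero_of_sum_ne_zero h
  refine ⟨σ.symm, fun i => ?_⟩
  by_contra hi
  refine hσ ?_
  rw [Finset.prod_eq_zero (Finset.mem_univ (σ.symm i)), smul_zero]
  simp only [classMatrix, Matrix.of_apply, Equiv.apply_symm_apply]
  exact if_neg fun h => hi h.symm

theorem enorm_det_classMatrix_comp_perm (c : ι → Fin M) (σ : Equiv.Perm ι) (z : ι → ℂ) :
    ‖(classMatrix M e (c ∘ σ) (z ∘ σ)).det‖ₑ = ‖(classMatrix M e c z).det‖ₑ := by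
  have : classMatrix M e (c ∘ σ) (z ∘ σ) = (classMatrix M e c z).submatrix σ id := by
    ext i j
    rfl
  rw [this, Matrix.det_permute, enorm_mul]
  rcases Int.units_eq_one_or (Equiv.Perm.sign σ) with h | h <;> simp [h]

end Algebra

theorem volume_preserving_pi_mul {ι : Type*} [Fintype ι] {u : ι → ℂ} (hu : ∀ i, ‖u i‖ = 1) :
    MeasurePreserving (fun (z : ι → ℂ) i => u i * z i) := by
  refine volume_preserving_pi (f := fun i z => u i * z) fun i => ?_
  exact (rotation ⟨u i, mem_sphere_zero_iff_norm.2 (hu i)⟩).measurePreserving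

theorem volume_preserving_comp_equiv {ι ι' : Type*} [Fintype ι] [Fintype ι'] (σ : ι ≃ ι') :
    MeasurePreserving (fun z : ι' → ℂ => z ∘ σ) := by
  have h := volume_measurePreserving_piCongrLeft (fun _ : ι => ℂ) σ.symm
  have heq : (fun z : ι' → ℂ => z ∘ σ) = MeasurableEquiv.piCongrLeft (fun _ : ι => ℂ) σ.symm := by
    funext z i
    have := Equiv.piCongrLeft_apply_apply (fun _ : ι => ℂ) σ.symm z (σ i)
    rw [Equiv.symm_apply_apply] at this
    exact this.symm
  rwa [heq]

theorem lintegral_mul_eq_sum_of_sum_rotate {ι : Type*} [Fintype ι] [DecidableEq ι] {M : ℕ}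
    (hM : M ≠ 0) {ω : ℂ} (hω : IsPrimitiveRoot ω M) {κ : Type*} [Fintype κ]
    {D G : (ι → ℂ) → ℝ≥0∞} {E : κ → (ι → ℂ) → ℝ≥0∞} (hD : Measurable D) (hG : Measurable G)
    (hE : ∀ c, Measurable (E c))
    (hDE : ∀ z, ∑ a : ι → Fin M, D (fun i => ω ^ (a i : ℕ) * z i) =
      M ^ Fintype.card ι * ∑ c, E c z)
    (hGu : ∀ (a : ι → Fin M) z, G (fun i => ω ^ (a i : ℕ) * z i) = G z) :
    ∫⁻ z, D z * G z = ∑ c, ∫⁻ z, E c z * G z := by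
  have hrot : ∀ a : ι → Fin M,
      ∫⁻ z : ι → ℂ, D z * G z = ∫⁻ z : ι → ℂ, D (fun i => ω ^ (a i : ℕ) * z i) * G z := by
    intro a
    have hn : ∀ i, ‖ω ^ (a i : ℕ)‖ = 1 := fun i => by
      rw [norm_pow, hω.norm'_eq_one hM, one_pow]
    rw [← (volume_preserving_pi_mul hn).lintegral_comp (by fun_prop : Measurable fun z => D z * G z)]
    exact lintegral_congr fun z => by rw [hGu]
  have h1 := Finset.sum_congr (rfl : (Finset.univ : Finset (ι → Fin M)) = _) fun a _ => hrot a
  rw [Finset.sum_const, Finset.card_univ, Fintype.card_fun, Fintype.card_fin, nsmul_eq_mul,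
    Nat.cast_pow, ← lintegral_finsetSum] at h1
  · have hM0 : (M : ℝ≥0∞) ^ Fintype.card ι ≠ 0 := pow_ne_zero _ (by exact_mod_cast hM)
    rw [← ENNReal.mul_right_inj hM0 (ENNReal.pow_ne_top (ENNReal.natCast_ne_top _)), h1,
      ← lintegral_finsetSum _ fun c _ => (by fun_prop : Measurable fun z => E c z * G z),
      ← lintegral_const_mul _ (by fun_prop)]
    refine lintegral_congr fun z => ?_
    rw [← Finset.sum_mul, hDE, ← Finset.sum_mul, mul_assoc]
  · exact fun a _ => (hD.comp (measurable_pi_lambda _ fun i => by fun_prop)).mul hG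

theorem measurable_enorm_det_pow {ι : Type*} [Fintype ι] [DecidableEq ι] (e : ι → ℕ) :
    Measurable fun z : ι → ℂ => ‖(Matrix.of fun i j => z i ^ e j : Matrix ι ι ℂ).det‖ₑ := by
  simp only [Matrix.det_apply, Matrix.of_apply]
  refine (Finset.measurable_sum _ fun σ _ => (Finset.measurable_prod _
    fun i _ => ?_).const_smul _).enorm
  fun_prop

theorem measurable_enorm_det_classMatrix {ι : Type*} [Fintype ι] [DecidableEq ι] {M : ℕ}
    (e : ι → ℕ) (c : ι → Fin M) : Measurable fun z : ι → ℂ => ‖(classMatrix M e c z).det‖ₑ := by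
  simp only [Matrix.det_apply, classMatrix, Matrix.of_apply]
  refine (Finset.measurable_sum _ fun σ _ => (Finset.measurable_prod _
    fun i _ => ?_).const_smul _).enorm
  split_ifs <;> fun_prop

theorem exists_lintegral_enorm_det_eq {ι : Type*} [Fintype ι] [DecidableEq ι] {M : ℕ} (hM : M ≠ 0)
    (e : ι → ℕ) (c₀ : ι → Fin M) (hc₀ : ∀ i, (c₀ i : ℕ) = e i % M) :
    ∃ C : ℕ, C ≠ 0 ∧ ∀ G : (ι → ℂ) → ℝ≥0∞, Measurable G →
      (∀ (σ : Equiv.Perm ι) z, G (z ∘ σ) = G z) →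
      (∀ u z : ι → ℂ, (∀ i, u i ^ M = 1) → G (fun i => u i * z i) = G z) →
      ∫⁻ z, ‖(Matrix.of fun i j => z i ^ e j : Matrix ι ι ℂ).det‖ₑ ^ 2 * G z =
        C * ∫⁻ z, ‖(classMatrix M e c₀ z).det‖ₑ ^ 2 * G z := by
  classical
  refine ⟨(Finset.univ.filter fun c : ι → Fin M => ∃ σ : Equiv.Perm ι, c = c₀ ∘ σ).card, ?_,
    fun G hG hGσ hGu => ?_⟩
  · exact Finset.card_ne_zero.2 ⟨c₀, Finset.mem_filter.2 ⟨Finset.mem_univ _, 1, rfl⟩⟩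
  obtain ⟨ω, hω⟩ : ∃ ω : ℂ, IsPrimitiveRoot ω M := ⟨_, Complex.isPrimitiveRoot_exp M hM⟩
  rw [lintegral_mul_eq_sum_of_sum_rotate hM hω ((measurable_enorm_det_pow e).pow_const 2) hG
      (fun c => (measurable_enorm_det_classMatrix e c).pow_const 2) (sum_enorm_det_rotate e hM hω)
      fun a z => hGu _ z fun i => by
        rw [← pow_mul, mul_comm, pow_mul, hω.pow_eq_one, one_pow],
    ← Finset.sum_filter_add_sum_filter_not _
      fun c : ι → Fin M => ∃ σ : Equiv.Perm ι, c = c₀ ∘ σ]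
  rw [Finset.sum_congr rfl (g := fun _ => ∫⁻ z, ‖(classMatrix M e c₀ z).det‖ₑ ^ 2 * G z)]
  · rw [Finset.sum_const, nsmul_eq_mul, Finset.sum_eq_zero, add_zero]
    intro c hc
    refine (lintegral_congr fun z => ?_).trans lintegral_zero
    have h0 : (classMatrix M e c z).det = 0 := by
      by_contra h
      obtain ⟨σ, hσ⟩ := exists_perm_of_det_classMatrix_ne_zero e h
      exact (Finset.mem_filter.1 hc).2
        ⟨σ, funext fun i => Fin.ext ((hσ i).trans (hc₀ (σ i)).symm)⟩
    simp [h0]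
  · intro c hc
    obtain ⟨σ, rfl⟩ := (Finset.mem_filter.1 hc).2
    have hm : Measurable fun z => ‖(classMatrix M e (c₀ ∘ σ) z).det‖ₑ ^ 2 * G z :=
      ((measurable_enorm_det_classMatrix e _).pow_const 2).mul hG
    rw [← (volume_preserving_comp_equiv σ).lintegral_comp hm]
    refine lintegral_congr fun z => ?_
    rw [enorm_det_classMatrix_comp_perm, hGσ]

theorem prod_filter_lt_eq_prod_Ioi {ι α : Type*} [Fintype ι] [LinearOrder ι]
    [LocallyFiniteOrderTop ι] [CommMonoid α] (f : ι → ι → α) :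
    ∏ p : ι × ι with p.1 < p.2, f p.1 p.2 = ∏ i, ∏ j ∈ Finset.Ioi i, f i j := by
  rw [Finset.prod_filter, Fintype.prod_prod_type]
  refine Finset.prod_congr rfl fun i _ => ?_
  rw [← Finset.prod_filter]
  exact Finset.prod_congr (by ext; simp) fun _ _ => rfl

theorem enorm_finset_prod {ι : Type*} (s : Finset ι) (f : ι → ℂ) :
    ‖∏ i ∈ s, f i‖ₑ = ∏ i ∈ s, ‖f i‖ₑ := by
  simp [enorm, nnnorm_prod]

theorem enorm_det_pow_sq {ι : Type*} [Fintype ι] [LinearOrder ι] [DecidableEq ι] {n : ℕ} (o : Fin n ≃o ι)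
    (v : ι → ℂ) :
    ‖(Matrix.of fun i j => v i ^ (o.symm j : ℕ) : Matrix ι ι ℂ).det‖ₑ ^ 2 =
      ∏ p : ι × ι with p.1 < p.2, ‖v p.1 - v p.2‖ₑ ^ 2 := by
  rw [← Matrix.det_submatrix_equiv_self o.toEquiv]
  have : (Matrix.of fun i j => v i ^ (o.symm j : ℕ) : Matrix ι ι ℂ).submatrix o.toEquiv o.toEquiv =
      Matrix.vandermonde (v ∘ o) := by
    ext i j
    simp [Matrix.vandermonde]
  rw [this, Matrix.det_vandermonde, ← prod_filter_lt_eq_prod_Ioi (fun i j => (v ∘ o) j - (v ∘ o) i),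
    Finset.prod_filter, Finset.prod_filter, ← (o.toEquiv.prodCongr o.toEquiv).prod_comp]
  rw [enorm_finset_prod, ← Finset.prod_pow]
  refine Finset.prod_congr rfl fun p _ => ?_
  have hlt : o p.1 < o p.2 ↔ p.1 < p.2 := o.lt_iff_lt
  change ‖ite _ (v (o p.2) - v (o p.1)) 1‖ₑ ^ 2 =
    ite (o p.1 < o p.2) (‖v (o p.1) - v (o p.2)‖ₑ ^ 2) 1
  by_cases h : p.1 < p.2
  · rw [if_pos h, if_pos (hlt.2 h), ← enorm_neg, neg_sub]
  · rw [if_neg h, if_neg fun h' => h (hlt.1 h')]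
    simp

theorem mem_progression_iff {N M k i : ℕ} :
    i ∈ progression N M k ↔ (1 ≤ i ∧ i ≤ N) ∧ i ≡ k [MOD M] := by
  simp [progression]

theorem exists_orderIso_progression {N M k : ℕ} (hk1 : 1 ≤ k) (hkM : k ≤ M) :
    ∃ (n : ℕ) (o : Fin n ≃o progression N M k), ∀ l, (o l : ℕ) = k + M * l := by
  have hM : 0 < M := by omega
  have hlt : ∀ l, l < (N + M - k) / M ↔ k + M * l ≤ N := fun l => by
    rw [← Nat.succ_le_iff, Nat.le_div_iff_mul_le hM, Nat.succ_mul, mul_comm]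
    omega
  let f : Fin ((N + M - k) / M) → progression N M k := fun l => ⟨k + M * l,
    mem_progression_iff.2 ⟨⟨by omega, (hlt l).1 l.2⟩, by simp [Nat.ModEq]⟩⟩
  have hf : StrictMono f := fun a b hab => by
    change k + M * (a : ℕ) < k + M * (b : ℕ)
    have : (a : ℕ) < b := hab
    gcongr
  have hs : Function.Surjective f := by
    rintro ⟨i, hi⟩
    obtain ⟨⟨h1, h2⟩, h3⟩ := mem_progression_iff.1 hi
    have hki : k ≤ i := by
      by_contra h
      have hd := (Nat.modEq_iff_dvd' (by omega)).1 h3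
      have := Nat.le_of_dvd (by omega) hd
      omega
    obtain ⟨l, hl⟩ := (Nat.modEq_iff_dvd' hki).1 h3.symm
    exact ⟨⟨l, (hlt l).2 (by omega)⟩, Subtype.ext (show k + M * l = i by omega)⟩
  exact ⟨_, hf.orderIsoOfSurjective f hs, fun l => rfl⟩

theorem enorm_det_progression_sq {N M k : ℕ} (hk1 : 1 ≤ k) (hkM : k ≤ M)
    (z : progression N M k → ℂ) :
    ‖(Matrix.of fun i j : progression N M k => z i ^ ((j : ℕ) - 1)).det‖ₑ ^ 2 =
      (∏ p : progression N M k × progression N M k with p.1 < p.2,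
        ‖z p.1 ^ M - z p.2 ^ M‖ₑ ^ 2) * ∏ i, ‖z i‖ₑ ^ (2 * (k - 1)) := by
  obtain ⟨n, o, ho⟩ := exists_orderIso_progression (N := N) hk1 hkM
  have : (Matrix.of fun i j : progression N M k => z i ^ ((j : ℕ) - 1)) =
      Matrix.of fun i j => z i ^ (k - 1) *
        (Matrix.of fun i j => (z i ^ M) ^ (o.symm j : ℕ) : Matrix _ _ ℂ) i j := by
    ext i j
    have h := ho (o.symm j)
    rw [OrderIso.apply_symm_apply] at h
    simp only [Matrix.of_apply]
    rw [← pow_mul, ← pow_add]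
    congr 1
    omega
  rw [this, Matrix.det_mul_column, enorm_mul, mul_pow,
    enorm_det_pow_sq o (fun i => z i ^ M), mul_comm]
  congr 1
  rw [enorm_finset_prod, ← Finset.prod_pow]
  simp_rw [enorm_pow, ← pow_mul, mul_comm]

theorem exists_equiv_sigma_progression (N M : ℕ) (hM : 1 ≤ M) :
    ∃ E : (Σ k : Finset.Icc 1 M, progression N M k) ≃ Fin N, ∀ p, (E p : ℕ) = (p.2 : ℕ) - 1 := by
  have hp : ∀ p : Σ k : Finset.Icc 1 M, progression N M k, (p.2 : ℕ) - 1 < N := fun p => by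
    have := mem_progression_iff.1 p.2.2
    omega
  refine ⟨Equiv.ofBijective (fun p => ⟨(p.2 : ℕ) - 1, hp p⟩) ⟨?_, ?_⟩, fun p => rfl⟩
  · rintro ⟨⟨k, hk⟩, ⟨i, hi⟩⟩ ⟨⟨k', hk'⟩, ⟨i', hi'⟩⟩ h
    have h : i - 1 = i' - 1 := congrArg Fin.val h
    have h1 := mem_progression_iff.1 hi
    have h1' := mem_progression_iff.1 hi'
    obtain rfl : i = i' := by omega
    rw [Finset.mem_Icc] at hk hk'
    obtain rfl : k = k' := by
      have h2 : k - 1 + 1 ≡ k' - 1 + 1 [MOD M] := by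
        rw [Nat.sub_add_cancel hk.1, Nat.sub_add_cancel hk'.1]
        exact h1.2.symm.trans h1'.2
      have := Nat.ModEq.eq_of_lt_of_lt (Nat.ModEq.add_right_cancel' 1 h2) (by omega) (by omega)
      omega
    rfl
  · intro i
    refine ⟨⟨⟨i % M + 1, ?_⟩, ⟨i + 1, ?_⟩⟩, rfl⟩
    · have := Nat.mod_lt (i : ℕ) hM
      rw [Finset.mem_Icc]
      omega
    · exact mem_progression_iff.2 ⟨⟨by omega, by omega⟩, (Nat.mod_modEq _ _).symm.add_right 1⟩

theorem det_blockDiagonal_sigma {κ : Type*} [Fintype κ] [LinearOrder κ] [DecidableEq κ] {ι : κ → Type*}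
    [∀ k, Fintype (ι k)] [∀ k, DecidableEq (ι k)] (A : ∀ k, Matrix (ι k) (ι k) ℂ) :
    (Matrix.blockDiagonal' A).det = ∏ k, (A k).det := by
  rw [(Matrix.blockTriangular_blockDiagonal' A).det_fintype]
  refine Finset.prod_congr rfl fun k _ => ?_
  let q : ι k ≃ {p : Σ k, ι k // p.1 = k} :=
    Equiv.ofBijective (fun i => ⟨⟨k, i⟩, rfl⟩) ⟨fun i j h => by simpa using h, by
      rintro ⟨⟨k', i⟩, h⟩
      obtain rfl : k' = k := h
      exact ⟨i, rfl⟩⟩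
  rw [← Matrix.det_submatrix_equiv_self q]
  congr 1
  ext i j
  exact Matrix.blockDiagonal'_apply_eq A k i j

theorem pred_mod_eq {N M k i : ℕ} (hk : k ∈ Finset.Icc 1 M) (hi : i ∈ progression N M k) :
    (i - 1) % M = k - 1 := by
  rw [Finset.mem_Icc] at hk
  have h := mem_progression_iff.1 hi
  have h2 : i - 1 + 1 ≡ k - 1 + 1 [MOD M] := by
    rw [Nat.sub_add_cancel hk.1, Nat.sub_add_cancel h.1.1]
    exact h.2
  have h3 : (i - 1) % M = (k - 1) % M := Nat.ModEq.add_right_cancel' 1 h2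
  rw [h3, Nat.mod_eq_of_lt (by omega)]

/-- The residue class `k - 1` of the exponents `i - 1`, `i ∈ I_{N,M,k}`. -/
def progressionClass (N M : ℕ) (p : Σ k : Finset.Icc 1 M, progression N M k) : Fin M :=
  ⟨p.1 - 1, by have := Finset.mem_Icc.1 p.1.2; omega⟩

theorem enorm_det_classMatrix_progression_sq {N M : ℕ}
    (z : ∀ k : Finset.Icc 1 M, progression N M k → ℂ) :
    ‖(classMatrix M (fun p => (p.2 : ℕ) - 1) (progressionClass N M) (Sigma.uncurry z)).det‖ₑ ^ 2 =
      ∏ k : Finset.Icc 1 M,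
        (∏ p : progression N M k × progression N M k with p.1 < p.2,
          ‖z k p.1 ^ M - z k p.2 ^ M‖ₑ ^ 2) * ∏ i, ‖z k i‖ₑ ^ (2 * ((k : ℕ) - 1)) := by
  have : classMatrix M (fun p => (p.2 : ℕ) - 1) (progressionClass N M) (Sigma.uncurry z) =
      Matrix.blockDiagonal' fun k : Finset.Icc 1 M =>
        Matrix.of fun i j : progression N M k => z k i ^ ((j : ℕ) - 1) := by
    ext ⟨k, i⟩ ⟨k', j⟩
    change ite (((j : ℕ) - 1) % M = (k : ℕ) - 1) (z k i ^ ((j : ℕ) - 1)) 0 = _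
    rw [pred_mod_eq k'.2 j.2]
    by_cases h : k = k'
    · subst h
      rw [if_pos rfl, Matrix.blockDiagonal'_apply_eq, Matrix.of_apply]
    · rw [Matrix.blockDiagonal'_apply_ne _ _ _ h, if_neg]
      have h1 := Finset.mem_Icc.1 k.2
      have h2 := Finset.mem_Icc.1 k'.2
      have h3 : (k : ℕ) ≠ k' := fun h3 => h (Subtype.ext h3)
      omega
  rw [this, det_blockDiagonal_sigma, enorm_finset_prod,
    ← Finset.prod_pow]
  exact Finset.prod_congr rfl fun k _ => enorm_det_progression_sq (Finset.mem_Icc.1 k.2).1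
    (Finset.mem_Icc.1 k.2).2 (z k)

theorem lintegral_and_map_lawOfDensity {ι : Type*} [Fintype ι] {p : (ι → ℂ) → (ι → ℂ)}
    {f g h : (ι → ℂ) → ℝ≥0∞} (hg : Measurable g) (hh : Measurable h)
    (hp : MeasurePreserving p (volume.withDensity h) volume) {c : ℝ≥0∞} (hc0 : c ≠ 0)
    (hc : c ≠ ∞) (hf : f =ᵐ[volume] fun z => c * (h z * g (p z))) :
    ∫⁻ z, f z = c * ∫⁻ z, g z ∧ (lawOfDensity f).map p = lawOfDensity g := by
  have hgp : Measurable fun z => g (p z) := hg.comp hp.measurable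
  have hhgp : Measurable fun z => h z * g (p z) := hh.mul hgp
  have key : ∀ s, MeasurableSet s → ∫⁻ z in p ⁻¹' s, f z = c * ∫⁻ z in s, g z := fun s hs => by
    rw [lintegral_congr_ae (ae_restrict_of_ae hf), lintegral_const_mul _ hhgp,
      ← hp.setLIntegral_comp_preimage hs hg, setLIntegral_withDensity_eq_setLIntegral_mul _ hh hgp
        (hp.measurable hs)]
    rfl
  have htot : ∫⁻ z, f z = c * ∫⁻ z, g z := by simpa using key Set.univ .univ
  refine ⟨htot, Measure.ext fun s hs => ?_⟩
  rw [Measure.map_apply hp.measurable hs, lawOfDensity, lawOfDensity, Measure.smul_apply,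
    Measure.smul_apply, withDensity_apply _ (hp.measurable hs), withDensity_apply _ hs, key s hs,
    htot, smul_eq_mul, smul_eq_mul, ENNReal.mul_inv (.inl hc0) (.inl hc), mul_comm c⁻¹, mul_assoc,
    ← mul_assoc c⁻¹, ENNReal.inv_mul_cancel hc0 hc, one_mul]

theorem betaDensity_two (V : ℝ≥0 → EReal) (ι : Type*) [Fintype ι] [LinearOrder ι] (z : ι → ℂ) :
    betaDensity 2 V ι z = (∏ p : ι × ι with p.1 < p.2, ‖z p.1 - z p.2‖ₑ ^ 2) *
      ∏ i, EReal.exp (-V (‖z i‖₊ ^ 2)) := by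
  simp only [betaDensity, ENNReal.rpow_two]

theorem measurable_exp_neg_potential {V : ℝ≥0 → EReal} (hV : Measurable V) :
    Measurable fun z : ℂ => EReal.exp (-V (‖z‖₊ ^ 2)) := by
  have : Measurable fun z : ℂ => V (‖z‖₊ ^ 2) := hV.comp (by fun_prop)
  exact this.neg.ereal_exp

theorem measurable_betaDensity_two {V : ℝ≥0 → EReal} (hV : Measurable V) (ι : Type*) [Fintype ι]
    [LinearOrder ι] : Measurable (betaDensity 2 V ι) := by
  have := measurable_exp_neg_potential hV
  simp only [funext (betaDensity_two V ι)]
  refine Measurable.mul (Finset.measurable_prod _ fun p _ => by fun_prop)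
    (Finset.measurable_prod _ fun i _ => this.comp (measurable_pi_apply i))

theorem measurable_rootDensity {V : ℝ≥0 → EReal} (hV : Measurable V) (N M k : ℕ) :
    Measurable (rootDensity V N M k) := by
  have := measurable_exp_neg_potential hV
  unfold rootDensity
  refine Measurable.mul (Finset.measurable_prod _ fun p _ => by fun_prop)
    (Finset.measurable_prod _ fun i _ =>
      Measurable.mul (by fun_prop) (this.comp (measurable_pi_apply i)))

theorem measurable_powerPotential {V : ℝ≥0 → EReal} (hV : Measurable V) (M k : ℕ) :
    Measurable (powerPotential V M k) := by
  have h1 : Measurable fun x : ℝ≥0 => V (x ^ (1 / (M : ℝ))) := hV.comp (by fun_prop)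
  have h2 : Measurable fun x : ℝ≥0 => (((k : ℝ) - M) / M * Real.log x : ℝ) :=
    (Real.measurable_log.comp measurable_subtype_coe).const_mul _
  unfold powerPotential
  simp only [sub_eq_add_neg]
  exact h1.add h2.coe_real_ereal.neg

theorem powerPotential_ne_bot {V : ℝ≥0 → EReal} (hV : ∀ t, V t ≠ ⊥) (M k : ℕ) (x : ℝ≥0) :
    powerPotential V M k x ≠ ⊥ := by
  unfold powerPotential
  rw [sub_eq_add_neg, ← EReal.coe_neg]
  exact EReal.add_ne_bot_iff.2 ⟨hV _, EReal.coe_ne_bot _⟩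

theorem exp_neg_powerPotential {V : ℝ≥0 → EReal} {M k : ℕ} (hk1 : 1 ≤ k)
    (hkM : k ≤ M) {z : ℂ} (hz : z ≠ 0) :
    ‖z‖ₑ ^ (2 * (M - 1)) * EReal.exp (-powerPotential V M k (‖z ^ M‖₊ ^ 2)) =
      ‖z‖ₑ ^ (2 * (k - 1)) * EReal.exp (-V (‖z‖₊ ^ 2)) := by
  have hM : (M : ℝ) ≠ 0 := by
    have : M ≠ 0 := by omega
    exact_mod_cast this
  have hr : 0 < ‖z‖ := norm_pos_iff.2 hz
  have hx : (‖z ^ M‖₊ ^ 2) ^ (1 / (M : ℝ)) = ‖z‖₊ ^ 2 := by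
    rw [nnnorm_pow, ← pow_mul, mul_comm, pow_mul, one_div,
      NNReal.pow_rpow_inv_natCast _ (by omega)]
  have hlog : ((k : ℝ) - M) / M * Real.log ((‖z ^ M‖₊ ^ 2 : ℝ≥0) : ℝ) =
      2 * (k - M) * Real.log ‖z‖ := by
    push_cast
    rw [norm_pow, Real.log_pow, Real.log_pow]
    push_cast
    field_simp
  have he : ∀ n : ℕ, ‖z‖ₑ ^ n = ENNReal.ofReal (Real.exp (n * Real.log ‖z‖)) := fun n => by
    rw [Real.exp_nat_mul, Real.exp_log hr, ENNReal.ofReal_pow hr.le, ofReal_norm]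
  rw [powerPotential, hx, hlog, EReal.neg_sub (.inr (EReal.coe_ne_bot _))
    (.inr (EReal.coe_ne_top _)), EReal.exp_add, EReal.exp_coe, mul_comm (EReal.exp _), ← mul_assoc,
    he, he, ← ENNReal.ofReal_mul (Real.exp_nonneg _), ← Real.exp_add]
  congr 3
  push_cast [Nat.cast_sub hk1, Nat.cast_sub (hk1.trans hkM)]
  ring

theorem rootDensity_ae_eq (V : ℝ≥0 → EReal) {N M k : ℕ} (hk1 : 1 ≤ k) (hkM : k ≤ M) :
    rootDensity V N M k =ᵐ[volume] fun z =>
      ((M : ℝ≥0∞) ^ (progression N M k).card)⁻¹ * ((∏ i, (M * ‖z i‖ₑ ^ (2 * (M - 1)))) *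
        betaDensity 2 (powerPotential V M k) (progression N M k) fun i => z i ^ M) := by
  have hz : ∀ᵐ z : progression N M k → ℂ, ∀ i, z i ≠ 0 := by
    refine ae_all_iff.2 fun i => ?_
    have h : ∀ᵐ w : ℂ, w ≠ 0 := by simp [ae_iff]
    exact (Measure.quasiMeasurePreserving_eval
      (fun _ : progression N M k => (volume : Measure ℂ)) i).ae h
  filter_upwards [hz] with z hz
  have hM0 : (M : ℝ≥0∞) ≠ 0 := by
    have : M ≠ 0 := by omega
    exact_mod_cast this
  rw [betaDensity_two, Finset.prod_mul_distrib, Finset.prod_const, Finset.card_univ,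
    Fintype.card_coe, mul_assoc, ← mul_assoc _⁻¹, ENNReal.inv_mul_cancel (pow_ne_zero _ hM0)
      (ENNReal.pow_ne_top (ENNReal.natCast_ne_top _)), one_mul, mul_left_comm,
    ← Finset.prod_mul_distrib]
  simp_rw [exp_neg_powerPotential hk1 hkM (hz _)]
  rfl

theorem lintegral_rootDensity_and_powerEnsemble_eq {V : ℝ≥0 → EReal} (hV : Measurable V)
    {N M k : ℕ} (hk1 : 1 ≤ k) (hkM : k ≤ M) :
    ∫⁻ z, rootDensity V N M k z = ((M : ℝ≥0∞) ^ (progression N M k).card)⁻¹ *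
        ∫⁻ z, betaDensity 2 (powerPotential V M k) (progression N M k) z ∧
      powerEnsemble V N M k = betaEnsemble 2 (powerPotential V M k) (progression N M k) := by
  have hM : M ≠ 0 := by omega
  have hM0 : (M : ℝ≥0∞) ≠ 0 := by exact_mod_cast hM
  exact lintegral_and_map_lawOfDensity
    (measurable_betaDensity_two (measurable_powerPotential hV M k) _)
    (Finset.measurable_prod _ fun i _ => by fun_prop) (measurePreserving_pi_pow_withDensity hM)
    (ENNReal.inv_ne_zero.2 (ENNReal.pow_ne_top (ENNReal.natCast_ne_top _)))
    (ENNReal.inv_ne_top.2 (pow_ne_zero _ hM0)) (rootDensity_ae_eq V hk1 hkM)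

theorem pointSet_comp_equiv {ι ι' : Type*} [Fintype ι] [Fintype ι'] (σ : ι ≃ ι') (z : ι' → ℂ) :
    pointSet (z ∘ σ) = pointSet z :=
  σ.sum_comp fun i => Measure.dirac (z i)

theorem pointSet_sigmaUncurry {κ : Type*} [Fintype κ] {ι : κ → Type*} [∀ k, Fintype (ι k)]
    (z : ∀ k, ι k → ℂ) :
    pointSet (Sigma.uncurry z : (Σ k, ι k) → ℂ) = ∑ k, pointSet (z k) :=
  Fintype.sum_sigma _

theorem exists_lintegral_betaDensity_mul_eq (N : ℕ) {M : ℕ} (hM : 1 ≤ M) {V : ℝ≥0 → EReal}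
    (hV : Measurable V) :
    ∃ C : ℕ, C ≠ 0 ∧ ∀ H : Measure ℂ → ℝ≥0∞, Measurable H →
      ∫⁻ z, betaDensity 2 V (Fin N) z * H (pointSet fun i => z i ^ M) =
        C * ∫⁻ z : ∀ k : Finset.Icc 1 M, progression N M k → ℂ,
          (∏ k : Finset.Icc 1 M, rootDensity V N M k (z k)) * H (∑ k, pointSet fun i => z k i ^ M) := by
  classical
  obtain ⟨E, hE⟩ := exists_equiv_sigma_progression N M hM
  obtain ⟨C, hC, h⟩ := exists_lintegral_enorm_det_eq (M := M) (by omega)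
    (fun p : Σ k : Finset.Icc 1 M, progression N M k => (p.2 : ℕ) - 1) (progressionClass N M)
    fun p => (pred_mod_eq p.1.2 p.2.2).symm
  refine ⟨C, hC, fun H hH => ?_⟩
  have hw := measurable_exp_neg_potential hV
  let G : ((Σ k : Finset.Icc 1 M, progression N M k) → ℂ) → ℝ≥0∞ := fun z =>
    (∏ p, EReal.exp (-V (‖z p‖₊ ^ 2))) * H (pointSet fun p => z p ^ M)
  have hG : Measurable G := by
    refine Measurable.mul (Finset.measurable_prod _ fun p _ => hw.comp (measurable_pi_apply p))
      (hH.comp (measurable_pointSet.comp ?_))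
    fun_prop
  have hGσ : ∀ (σ : Equiv.Perm (Σ k : Finset.Icc 1 M, progression N M k)) z,
      G (z ∘ σ) = G z := fun σ z => by
    have h1 : pointSet (fun p => (z ∘ σ) p ^ M) = pointSet fun p => z p ^ M :=
      pointSet_comp_equiv σ fun p => z p ^ M
    have h2 : ∏ p, EReal.exp (-V (‖(z ∘ σ) p‖₊ ^ 2)) = ∏ p, EReal.exp (-V (‖z p‖₊ ^ 2)) :=
      Equiv.prod_comp σ fun p => EReal.exp (-V (‖z p‖₊ ^ 2))
    simp only [G, h1, h2]
  have hGu : ∀ u z : (Σ k : Finset.Icc 1 M, progression N M k) → ℂ, (∀ i, u i ^ M = 1) →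
      G (fun i => u i * z i) = G z := fun u z hu => by
    have hn : ∀ i, ‖u i‖₊ = 1 := fun i =>
      NNReal.eq (Complex.norm_eq_one_of_pow_eq_one (hu i) (by omega))
    simp only [G, mul_pow, hu, one_mul, nnnorm_mul, hn]
  have hbeta : ∀ z : Fin N → ℂ, betaDensity 2 V (Fin N) z * H (pointSet fun i => z i ^ M) =
      ‖(Matrix.of fun i j : Σ k : Finset.Icc 1 M, progression N M k =>
        (z ∘ E) i ^ ((j.2 : ℕ) - 1)).det‖ₑ ^ 2 * G (z ∘ E) := fun z => by
    have h1 : pointSet (fun p => (z ∘ E) p ^ M) = pointSet fun p => z p ^ M :=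
      pointSet_comp_equiv E fun p => z p ^ M
    have h2 : ∏ p, EReal.exp (-V (‖(z ∘ E) p‖₊ ^ 2)) = ∏ p, EReal.exp (-V (‖z p‖₊ ^ 2)) :=
      E.prod_comp fun p => EReal.exp (-V (‖z p‖₊ ^ 2))
    have h3 : (Matrix.of fun i j : Σ k : Finset.Icc 1 M, progression N M k =>
        (z ∘ E) i ^ ((j.2 : ℕ) - 1)) =
        (Matrix.of fun i j : Fin N => z i ^ ((OrderIso.refl (Fin N)).symm j : ℕ)).submatrix E E := by
      ext i j
      simp [hE]
    simp only [G, h1, h2]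
    rw [h3, Matrix.det_submatrix_equiv_self, enorm_det_pow_sq, betaDensity_two, mul_assoc]
  have hDG : Measurable fun z : (Σ k : Finset.Icc 1 M, progression N M k) → ℂ =>
      ‖(Matrix.of fun i j : Σ k : Finset.Icc 1 M, progression N M k =>
        z i ^ ((j.2 : ℕ) - 1)).det‖ₑ ^ 2 * G z :=
    ((measurable_enorm_det_pow _).pow_const 2).mul hG
  simp_rw [hbeta]
  rw [(volume_preserving_comp_equiv E).lintegral_comp hDG, h G hG hGσ hGu,
    ← (volume_preserving_sigmaUncurry (ι := fun k : Finset.Icc 1 M =>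
      progression N M k)).lintegral_comp_emb (MeasurableEquiv.measurableEmbedding _)]
  congr 1
  refine lintegral_congr fun z => ?_
  rw [MeasurableEquiv.coe_piCurry_symm, enorm_det_classMatrix_progression_sq]
  have h1 : pointSet (fun p =>
      (Sigma.uncurry z : (Σ k : Finset.Icc 1 M, progression N M k) → ℂ) p ^ M) = ∑ k, pointSet fun i => z k i ^ M :=
    pointSet_sigmaUncurry fun (k : Finset.Icc 1 M) (i : progression N M k) => z k i ^ M
  have h2 : ∏ p, EReal.exp
        (-V (‖(Sigma.uncurry z : (Σ k : Finset.Icc 1 M, progression N M k) → ℂ) p‖₊ ^ 2)) =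
      ∏ k, ∏ i, EReal.exp (-V (‖z k i‖₊ ^ 2)) :=
    Fintype.prod_sigma _
  simp only [G, h1, h2]
  rw [← mul_assoc, ← Finset.prod_mul_distrib]
  congr 1
  refine Finset.prod_congr rfl fun k _ => ?_
  rw [mul_assoc, ← Finset.prod_mul_distrib]
  rfl

theorem mainTheorem2 (N M : ℕ) (hM : 1 ≤ M) (V : ℝ≥0 → EReal)
    (hV : IsAdmissiblePotential 2 V (Fin N)) :
    -- the ensembles are well defined, and each block is again a `β = 2` ensemble
    IsProbabilityMeasure (betaEnsemble 2 V (Fin N)) ∧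
    (∀ k ∈ Finset.Icc 1 M,
      IsProbabilityMeasure (rootEnsemble V N M k) ∧
      IsProbabilityMeasure (powerEnsemble V N M k) ∧
      IsAdmissiblePotential 2 (powerPotential V M k) (progression N M k) ∧
      powerEnsemble V N M k = betaEnsemble 2 (powerPotential V M k) (progression N M k)) ∧
    -- the set of `M`-th powers of the ensemble has the law of the set of `M`-th powers of
    -- independent Root blocks
    (betaEnsemble 2 V (Fin N)).map (fun l => pointSet (fun i => l i ^ M)) =
      (Measure.pi (fun k : Finset.Icc 1 M => rootEnsemble V N M k)).map
        (fun z => ∑ k, pointSet (fun i => z k i ^ M)) ∧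
    -- in other words, it is the superposition of the independent Power ensembles
    pointProcess ((betaEnsemble 2 V (Fin N)).map (fun l i => l i ^ M)) =
      superposition (fun k : Finset.Icc 1 M => powerEnsemble V N M k) := by
  classical
  obtain ⟨C, hC, hCH⟩ := exists_lintegral_betaDensity_mul_eq N hM hV.measurable
  have hC0 : (C : ℝ≥0∞) ≠ 0 := by exact_mod_cast hC
  have hroot := fun k => measurable_rootDensity hV.measurable N M k
  have htot : ∫⁻ z, betaDensity 2 V (Fin N) z =
      C * ∏ k : Finset.Icc 1 M, ∫⁻ z, rootDensity V N M k z := by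
    have h := hCH (fun _ => 1) measurable_const
    simp only [mul_one] at h
    rw [h, ← lintegral_fintype_prod_eq_prod _ fun k : Finset.Icc 1 M => hroot k]
    rfl
  have hprod0 : ∏ k : Finset.Icc 1 M, ∫⁻ z, rootDensity V N M k z ≠ 0 := fun h =>
    hV.integral_ne_zero (by rw [htot, h, mul_zero])
  have hprod1 : ∏ k : Finset.Icc 1 M, ∫⁻ z, rootDensity V N M k z ≠ ∞ := fun h =>
    hV.integral_ne_top (by rw [htot, h, ENNReal.mul_top hC0])
  have h0 : ∀ k : Finset.Icc 1 M, ∫⁻ z, rootDensity V N M k z ≠ 0 := fun k =>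
    Finset.prod_ne_zero_iff.1 hprod0 k (Finset.mem_univ k)
  have h1 : ∀ k : Finset.Icc 1 M, ∫⁻ z, rootDensity V N M k z ≠ ∞ := fun k hk => by
    refine hprod1 ?_
    rw [← Finset.mul_prod_erase _ _ (Finset.mem_univ k), hk, ENNReal.top_mul]
    exact Finset.prod_ne_zero_iff.2 fun j _ => h0 j
  have hprob : ∀ k : Finset.Icc 1 M, IsProbabilityMeasure (rootEnsemble V N M k) := fun k =>
    isProbabilityMeasure_lawOfDensity (h0 k) (h1 k)
  have hpow : ∀ k, Measurable fun (z : progression N M k → ℂ) i => z i ^ M := fun k => by fun_prop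
  have hpowN : Measurable fun (z : Fin N → ℂ) i => z i ^ M := by fun_prop
  have hpowprob : ∀ k : Finset.Icc 1 M, IsProbabilityMeasure (powerEnsemble V N M k) := fun k =>
    Measure.isProbabilityMeasure_map (hpow k).aemeasurable
  have hmain : (betaEnsemble 2 V (Fin N)).map (fun l => pointSet (fun i => l i ^ M)) =
      (Measure.pi (fun k : Finset.Icc 1 M => rootEnsemble V N M k)).map
        (fun z => ∑ k, pointSet (fun i => z k i ^ M)) := by
    have hm1 : Measurable fun l : Fin N → ℂ => pointSet fun i => l i ^ M :=
      measurable_pointSet.comp hpowN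
    have hm2 : Measurable fun z : ∀ k : Finset.Icc 1 M, progression N M k → ℂ =>
        ∑ k, pointSet fun i => z k i ^ M :=
      measurable_sum_pointSet.comp (measurable_pi_lambda _ fun k =>
        (hpow k).comp (measurable_pi_apply k))
    refine Measure.ext fun s hs => ?_
    have h := hCH (s.indicator 1) (measurable_one.indicator hs)
    simp only [Set.indicator_apply, Pi.one_apply, mul_ite, mul_one, mul_zero] at h
    rw [Measure.map_apply hm1 hs, Measure.map_apply hm2 hs, betaEnsemble, lawOfDensity]
    have hpi : Measure.pi (fun k : Finset.Icc 1 M => rootEnsemble V N M k) = _ :=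
      pi_lawOfDensity (fun k : Finset.Icc 1 M => hroot k) h0 h1
    rw [hpi, Measure.smul_apply, Measure.smul_apply,
      withDensity_apply _ (hm1 hs), withDensity_apply _ (hm2 hs), ← lintegral_indicator (hm1 hs),
      ← lintegral_indicator (hm2 hs), htot]
    simp only [Set.indicator_apply, Set.mem_preimage]
    rw [h, smul_eq_mul, smul_eq_mul, ENNReal.mul_inv (.inl hC0) (.inl (ENNReal.natCast_ne_top _)),
      mul_comm (C : ℝ≥0∞)⁻¹, mul_assoc, ← mul_assoc (C : ℝ≥0∞)⁻¹,
      ENNReal.inv_mul_cancel hC0 (ENNReal.natCast_ne_top _), one_mul]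
  refine ⟨isProbabilityMeasure_lawOfDensity hV.integral_ne_zero hV.integral_ne_top,
    fun k hk => ?_, hmain, ?_⟩
  · obtain ⟨hk1, hkM⟩ := Finset.mem_Icc.1 hk
    obtain ⟨hint, heq⟩ :=
      lintegral_rootDensity_and_powerEnsemble_eq (N := N) hV.measurable hk1 hkM
    have h0k := h0 ⟨k, hk⟩
    have h1k := h1 ⟨k, hk⟩
    simp only [hint] at h0k h1k
    refine ⟨hprob ⟨k, hk⟩, hpowprob ⟨k, hk⟩, ⟨measurable_powerPotential hV.measurable M k,
      powerPotential_ne_bot hV.ne_bot M k, fun h => h1k ?_, right_ne_zero_of_mul h0k⟩, heq⟩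
    rw [h, ENNReal.mul_top (left_ne_zero_of_mul h0k)]
  · have hpi : Measure.pi (fun k : Finset.Icc 1 M => powerEnsemble V N M k) =
        (Measure.pi fun k : Finset.Icc 1 M => rootEnsemble V N M k).map
          (fun z k i => z k i ^ M) := by
      have (k : Finset.Icc 1 M) : SigmaFinite
          ((rootEnsemble V N M k).map fun (z : progression N M k → ℂ) i => z i ^ M) := by
        have := hpowprob k
        unfold powerEnsemble at this
        infer_instance
      exact (Measure.pi_map_pi fun k : Finset.Icc 1 M => (hpow k).aemeasurable).symm
    have hm : Measurable fun (z : ∀ k : Finset.Icc 1 M, progression N M k → ℂ) k i => z k i ^ M :=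
      measurable_pi_lambda _ fun k => (hpow k).comp (measurable_pi_apply k)
    rw [pointProcess, Measure.map_map measurable_pointSet hpowN, superposition, hpi,
      Measure.map_map measurable_sum_pointSet hm]
    exact hmain

end
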